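/- Let $p$ be a prime, let $n\ge 2$, $N\ge 2$ and $0\le k\le N$ be integers, and let $R_{n,N,k}=\mathbb{Z}[x]/(p^N,\,x^n,\,p^kx^{n-1})$ (so $R_{n,N,0}=R_{n-1,N,N}$). Every nonzero $r\in R_{n,N,k}$ has a lowest nonzero term, which can be written $u\,p^m x^i$ with $u$ an integer prime to $p$; put $\nu(r)=(i,m)$, an element of $\mathcal{M}_{n,N}=\{0,\dots,n-1\}\times\{0,\dots,N-1\}$. On $\mathcal{M}_{n,N}$ consider the partial operation of componentwise addition, defined whenever the sum lies in $\mathcal{M}_{n,N}$. For a (unital) subring $S\subseteq R_{n,N,k}$ let $D(S)=\{\nu(r) : 0\ne r\in S\}$ be its set of exponents, and for $D\subseteq \mathcal{M}_{n,N}$ let $\mathcal{S}_{n,N,k}(D)$ be the set of subrings $S\subseteq R_{n,N,k}$ with $D(S)=D$. For $D\subseteq\mathcal{M}_{n,N}$ let $d(D)$ be the minimal cardinality of a subset $G\subseteq D$ such that every element of $D$ is a finite (possibly empty) sum of elements of $G$, repetitions allowed. Define integers $\epsilon_{n,N,k}(D)$ recursively by \[ \epsilon_{n,N,k}(D)=\begin{cases}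 0 & \text{if } n=1,\\ \epsilon_{n-1,N,N}(D) & \text{if } n>1,\ k=0,\\ \epsilon_{n,N,k-1}\bigl(D\setminus\{(n-1,k-1)\}\bigr) & \text{if } n>1,\ k\ge 1,\ (n-1,k-1)\in D,\\ d(D)-1+\epsilon_{n,N,k-1}(D) & \text{if } n>1,\ k\ge 1,\ (n-1,k-1)\notin D. \end{cases} \] Then for every subset $D\subseteq\mathcal{M}_{n,N}$ (in particular for every sub-partial-monoid $D$, that is, one containing $(0,0)$ and closed under the defined sums) the set $\mathcal{S}_{n,N,k}(D)$ is finite and \[ \#\,\mathcal{S}_{n,N,k}(D)\le p^{\epsilon_{n,N,k}(D)} . \] -/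

import Mathlib

open scoped Polynomial

noncomputable section

/-- The ideal `(p ^ N, x ^ n, p ^ k * x ^ (n - 1))` of `ℤ[x]`. -/
def truncIdeal (p n N k : ℕ) : Ideal ℤ[X] :=
  Ideal.span {Polynomial.C ((p : ℤ) ^ N), Polynomial.X ^ n,
    Polynomial.C ((p : ℤ) ^ k) * Polynomial.X ^ (n - 1)}

/-- The ring `R_{n,N,k} = ℤ[x] / (p ^ N, x ^ n, p ^ k * x ^ (n - 1))`. -/
abbrev TruncRing (p n N k : ℕ) : Type := ℤ[X] ⧸ truncIdeal p n N k

/-- `HasExponent r (i, m)` says `ν(r) = (i, m)`: the lowest nonzero term of `r` is `u * p ^ m * x ^ i`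
with `u` prime to `p`. That this term is nonzero in `R_{n,N,k}` is the first condition; it forces
`i < n`, `m < N`, and `m < k` if `i = n - 1`. -/
def HasExponent {p n N k : ℕ} (r : TruncRing p n N k) (e : ℕ × ℕ) : Prop :=
  Ideal.Quotient.mk (truncIdeal p n N k)
      (Polynomial.C ((p : ℤ) ^ e.2) * Polynomial.X ^ e.1) ≠ 0 ∧
    ∃ (u : ℤ) (g : ℤ[X]), ¬ (p : ℤ) ∣ u ∧
      r = Ideal.Quotient.mk (truncIdeal p n N k)
        (Polynomial.C (u * (p : ℤ) ^ e.2) * Polynomial.X ^ e.1 + Polynomial.X ^ (e.1 + 1) * g)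

/-- The set `D(S)` of exponents of the (nonzero) elements of a subring `S` of `R_{n,N,k}`. -/
def exponentSet {p n N k : ℕ} (S : Subring (TruncRing p n N k)) : Set (ℕ × ℕ) :=
  {e | ∃ r ∈ S, HasExponent r e}

/-- The set `S_{n,N,k}(D)` of subrings of `R_{n,N,k}` of shape `D`. -/
def subringsOfShape (p n N k : ℕ) (D : Finset (ℕ × ℕ)) : Set (Subring (TruncRing p n N k)) :=
  {S | exponentSet S = (D : Set (ℕ × ℕ))}

/-- The underlying set `{0, …, n - 1} × {0, …, N - 1}` of the partial monoid `M_{n,N}`; a sum is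
defined in it exactly when the sum in `ℕ × ℕ` lies in this set. -/
def exponentBox (n N : ℕ) : Finset (ℕ × ℕ) := Finset.range n ×ˢ Finset.range N

/-- `d(D)`: the least number of elements of a set `G ⊆ D` such that every element of `D` is a finite
sum of elements of `G`, repetitions allowed (the empty sum is `0`). As `M_{n,N}` contains with an
element all elements below it in both coordinates, a sum in `ℕ × ℕ` with value in `D` is defined in
`M_{n,N}`, in any order of summation. -/
def minGenerators (D : Finset (ℕ × ℕ)) : ℕ :=
  sInf {c | ∃ G : Finset (ℕ × ℕ), G ⊆ D ∧
    (D : Set (ℕ × ℕ)) ⊆ AddSubmonoid.closure (G : Set (ℕ × ℕ)) ∧ G.card = c}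

/-- `ε_{n,N,k}(D)`, as an integer; `shapeEps N n k D` with `ε_{n,N,0} = ε_{n-1,N,N}` for `n > 1`
(as `R_{n,N,0} = R_{n-1,N,N}`). The value at `n = 0` plays no role. -/
def shapeEps (N : ℕ) : ℕ → ℕ → Finset (ℕ × ℕ) → ℤ
  | 0, _, _ => 0
  | 1, _, _ => 0
  | n + 2, 0, D => shapeEps N (n + 1) N D
  | n + 2, k + 1, D =>
    if (n + 1, k) ∈ D then shapeEps N (n + 2) k (D.erase (n + 1, k))
    else (minGenerators D : ℤ) - 1 + shapeEps N (n + 2) k D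
termination_by n k => (n, k)

end

/-!
A subring `S` of `R_{n,N,k}` is replaced by its preimage `T` in `ℤ[X]`, so that all subrings live in
one ring without zero divisors, where leading terms are multiplicative, and a quotient is remembered
only through the weight `a` for which `f` lies in the ideal iff `p ^ a i` divides the `i`-th
coefficient of `f` for all `i` (`mem_truncIdeal_iff`).

The bound is proved by removing the monomial `q = p ^ k * X ^ n` from `R_{n+1,N,k+1}`; it spans an
ideal of order `p`. If `(n, k) ∈ D`, then `q ∈ T` for each `T` of shape `D`, so `T` is itself a
preimage from the smaller quotient `R_{n+1,N,k}`, of shape `D` without `(n, k)`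
(`liftedSubrings_subset_erase`). If `(n, k) ∉ D`, then `T + (q)` has shape `D` in the smaller
quotient (`addIdeal_mem_liftedSubrings`). Given `T' = T + (q)` and a minimal generating set `G` of
`D`, choose `r g ∈ T'` with exponent `g` for each `g ∈ G`. Then `r g + c g * q ∈ T` for some
`0 ≤ c g < p`, and these numbers determine `T`: products of the elements `r g + c g * q` have all
exponents in `D`, and by successive approximation a subring is determined within a larger one by
its exponents (`le_of_leadingExponents_subset`). The generator `(0, 1)`, which occurs in each `G`,
needs no choice, as `p` lies in every subring. This gives the factor `p ^ (d(D) - 1)`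
(`card_liftedSubrings_succ_le`).
-/

open Polynomial

/-- The exponent `a i` such that `p ^ m * x ^ i` vanishes in `R_{n,N,k}` exactly when `a i ≤ m`,
provided that `1 ≤ n` and `k ≤ N`. -/
def truncWeight (n N k i : ℕ) : ℕ :=
  if i + 1 < n then N else if i + 1 = n then k else 0

/-- The lowest nonzero term of the integer polynomial `f` is `u * p ^ e.2 * X ^ e.1` with `u` prime
to `p`. Nothing is truncated here, so that leading terms are multiplicative. -/
def HasLeadingTerm (p : ℕ) (f : ℤ[X]) (e : ℕ × ℕ) : Prop :=
  (∀ l < e.1, f.coeff l = 0) ∧ ∃ u : ℤ, ¬ (p : ℤ) ∣ u ∧ f.coeff e.1 = u * (p : ℤ) ^ e.2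

/-- The exponents of the leading terms of elements of `T` that survive in the quotient described by
the weight `a`. -/
def leadingExponents (p : ℕ) (a : ℕ → ℕ) (T : Subring ℤ[X]) : Set (ℕ × ℕ) :=
  {e | e.2 < a e.1 ∧ ∃ f ∈ T, HasLeadingTerm p f e}

/-- The preimages in `ℤ[X]` of the subrings of `R_{n,N,k}` of shape `D`. -/
def liftedSubrings (p n N k : ℕ) (D : Finset (ℕ × ℕ)) : Set (Subring ℤ[X]) :=
  {T | (∀ f ∈ truncIdeal p n N k, f ∈ T) ∧ leadingExponents p (truncWeight n N k) T = D}

/-! ### The truncation ideal in terms of coefficients -/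

lemma truncWeight_antitone {n N k : ℕ} (hk : k ≤ N) : Antitone (truncWeight n N k) := by
  intro i j hij
  unfold truncWeight
  split_ifs <;> omega

lemma mem_truncIdeal_iff {p n N k : ℕ} (hn : 1 ≤ n) (hk : k ≤ N) {f : ℤ[X]} :
    f ∈ truncIdeal p n N k ↔ ∀ i, (p : ℤ) ^ truncWeight n N k i ∣ f.coeff i := by
  constructor
  · intro hf
    unfold truncIdeal at hf
    induction hf using Submodule.span_induction with
    | mem g hg =>
      intro i
      rcases hg with rfl | rfl | rfl
      · rw [coeff_C]
        split_ifs with h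
        · exact pow_dvd_pow _ (by unfold truncWeight; split_ifs <;> omega)
        · exact dvd_zero _
      · rw [coeff_X_pow]
        split_ifs with h
        · subst h
          simp [truncWeight]
        · exact dvd_zero _
      · rw [coeff_C_mul_X_pow]
        split_ifs with h
        · exact pow_dvd_pow _ (by unfold truncWeight; split_ifs <;> omega)
        · exact dvd_zero _
    | zero => simp
    | add g h _ _ hg hh =>
      intro i
      rw [coeff_add]
      exact dvd_add (hg i) (hh i)
    | smul g h _ hh =>
      intro i
      rw [smul_eq_mul, coeff_mul]
      refine Finset.dvd_sum fun x hx => Dvd.dvd.mul_left ?_ _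
      exact (pow_dvd_pow _ (truncWeight_antitone hk
        (show x.2 ≤ i by rw [Finset.HasAntidiagonal.mem_antidiagonal] at hx; omega))).trans (hh x.2)
  · intro h
    rw [f.as_sum_support_C_mul_X_pow]
    refine Ideal.sum_mem _ fun i _ => ?_
    obtain ⟨c, hc⟩ := h i
    rw [hc]
    unfold truncWeight
    split_ifs with h1 h2
    · rw [C_mul, mul_assoc]
      exact Ideal.mul_mem_right _ _ (Ideal.subset_span (by simp))
    · obtain rfl : i = n - 1 := by omega
      rw [C_mul, mul_right_comm]
      exact Ideal.mul_mem_right _ _ (Ideal.subset_span (by simp))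
    · obtain ⟨j, rfl⟩ := Nat.exists_eq_add_of_le (show n ≤ i by omega)
      rw [pow_add, mul_left_comm]
      exact Ideal.mul_mem_right _ _ (Ideal.subset_span (by simp))

lemma C_mul_X_pow_mem_truncIdeal_iff {p n N k : ℕ} (hn : 1 ≤ n) (hk : k ≤ N) (c : ℤ) (i : ℕ) :
    C c * X ^ i ∈ truncIdeal p n N k ↔ (p : ℤ) ^ truncWeight n N k i ∣ c := by
  rw [mem_truncIdeal_iff hn hk]
  constructor
  · intro h
    simpa using h i
  · intro h j
    rw [coeff_C_mul_X_pow]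
    split_ifs with hj
    · rwa [hj]
    · exact dvd_zero _

lemma truncIdeal_zero_eq (p n N : ℕ) : truncIdeal p (n + 2) N 0 = truncIdeal p (n + 1) N N := by
  ext f
  rw [mem_truncIdeal_iff (by omega) (by omega), mem_truncIdeal_iff (by omega) le_rfl]
  refine forall_congr' fun i => ?_
  have : truncWeight (n + 2) N 0 i = truncWeight (n + 1) N N i := by
    unfold truncWeight; split_ifs <;> omega
  rw [this]

lemma liftedSubrings_zero_eq (p n N : ℕ) (D : Finset (ℕ × ℕ)) :
    liftedSubrings p (n + 2) N 0 D = liftedSubrings p (n + 1) N N D := by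
  have : truncWeight (n + 2) N 0 = truncWeight (n + 1) N N := by
    funext i; unfold truncWeight; split_ifs <;> omega
  unfold liftedSubrings
  rw [this, truncIdeal_zero_eq]

lemma truncIdeal_succ_le {p n N k : ℕ} (hk : k + 1 ≤ N) :
    truncIdeal p (n + 1) N (k + 1) ≤ truncIdeal p (n + 1) N k := by
  intro f
  rw [mem_truncIdeal_iff (by omega) hk, mem_truncIdeal_iff (by omega) (by omega)]
  refine fun h i => (pow_dvd_pow _ ?_).trans (h i)
  unfold truncWeight; split_ifs <;> omega

/-- Modulo the smaller ideal, the larger one consists of the integer multiples of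
`p ^ k * X ^ n`. -/
lemma exists_sub_mem_truncIdeal_succ {p n N k : ℕ} (hk : k + 1 ≤ N) {f : ℤ[X]}
    (hf : f ∈ truncIdeal p (n + 1) N k) :
    ∃ c : ℤ, f - C (c * (p : ℤ) ^ k) * X ^ n ∈ truncIdeal p (n + 1) N (k + 1) := by
  rw [mem_truncIdeal_iff (by omega) (by omega)] at hf
  obtain ⟨c, hc⟩ := hf n
  refine ⟨c, ?_⟩
  rw [mem_truncIdeal_iff (by omega) hk]
  intro i
  rw [coeff_sub, coeff_C_mul_X_pow]
  split_ifs with h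
  · subst h
    have : f.coeff i - c * (p : ℤ) ^ k = 0 := by
      rw [hc]; simp [truncWeight, mul_comm]
    rw [this]
    exact dvd_zero _
  · rw [sub_zero]
    refine (pow_dvd_pow _ ?_).trans (hf i)
    unfold truncWeight; split_ifs <;> omega

/-! ### Leading terms -/

lemma exists_dvd_sub_mul {p : ℕ} (hp : p.Prime) (u : ℤ) {v : ℤ} (hv : ¬ (p : ℤ) ∣ v) :
    ∃ c : ℤ, (p : ℤ) ∣ u - c * v := by
  obtain ⟨s, t, hst⟩ := (Prime.coprime_iff_not_dvd (Nat.prime_iff_prime_int.mp hp)).mpr hv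
  refine ⟨u * t, u * s, ?_⟩
  linear_combination (-u) * hst

lemma HasLeadingTerm.one {p : ℕ} (hp : p.Prime) : HasLeadingTerm p 1 0 :=
  ⟨by simp, 1, (Nat.prime_iff_prime_int.mp hp).not_dvd_one, by simp⟩

lemma HasLeadingTerm.mul {p : ℕ} (hp : p.Prime) {f g : ℤ[X]} {d e : ℕ × ℕ}
    (hf : HasLeadingTerm p f d) (hg : HasLeadingTerm p g e) : HasLeadingTerm p (f * g) (d + e) := by
  obtain ⟨hf0, u, hu, hfu⟩ := hf
  obtain ⟨hg0, v, hv, hgv⟩ := hg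
  obtain ⟨f', rfl⟩ := X_pow_dvd_iff.mpr hf0
  obtain ⟨g', rfl⟩ := X_pow_dvd_iff.mpr hg0
  have key : X ^ d.1 * f' * (X ^ e.1 * g') = X ^ (d + e).1 * (f' * g') := by
    rw [Prod.fst_add, pow_add]; ring
  rw [key]
  refine ⟨X_pow_dvd_iff.mp (dvd_mul_right _ _), u * v, ?_, ?_⟩
  · exact (Nat.prime_iff_prime_int.mp hp).not_dvd_mul hu hv
  · have h (h : ℤ[X]) (m : ℕ) : (X ^ m * h).coeff m = h.coeff 0 := by
      simpa using coeff_X_pow_mul h m 0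
    rw [h] at hfu hgv ⊢
    rw [mul_coeff_zero, hfu, hgv, Prod.snd_add, pow_add]
    ring

/-- Leading terms that survive modulo `p ^ k * X ^ n` are not changed by adding multiples of it. -/
lemma HasLeadingTerm.add_C_mul_X_pow {p n N k : ℕ} {f : ℤ[X]} {e : ℕ × ℕ}
    (hf : HasLeadingTerm p f e) (he : e.2 < truncWeight (n + 1) N k e.1) (c : ℤ) :
    HasLeadingTerm p (f + C (c * (p : ℤ) ^ k) * X ^ n) e := by
  obtain ⟨h0, u, hu, hfu⟩ := hf
  have hen : e.1 ≤ n := by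
    by_contra h
    rw [truncWeight, if_neg (by omega), if_neg (by omega)] at he
    omega
  refine ⟨fun l hl => ?_, ?_⟩
  · rw [coeff_add, h0 l hl, coeff_C_mul_X_pow, if_neg (by omega), add_zero]
  · rcases hen.lt_or_eq with h | h
    · exact ⟨u, hu, by rw [coeff_add, hfu, coeff_C_mul_X_pow, if_neg (by omega), add_zero]⟩
    · rw [truncWeight, if_neg (by omega), if_pos (by omega)] at he
      obtain ⟨j, rfl⟩ := Nat.exists_eq_add_of_lt he
      refine ⟨u + c * (p : ℤ) ^ (j + 1), fun hd => hu ?_, ?_⟩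
      · exact (dvd_add_left ((dvd_pow_self _ (by omega)).mul_left c)).mp hd
      · rw [coeff_add, hfu, coeff_C_mul_X_pow, if_pos h]
        ring

/-- The exponents of the leading terms of elements of a subring are closed under addition. -/
lemma exists_hasLeadingTerm_of_mem_closure {p : ℕ} (hp : p.Prime) {U : Subring ℤ[X]}
    {G : Set (ℕ × ℕ)} (hG : ∀ g ∈ G, ∃ f ∈ U, HasLeadingTerm p f g) {e : ℕ × ℕ}
    (he : e ∈ AddSubmonoid.closure G) : ∃ f ∈ U, HasLeadingTerm p f e := by
  induction he using AddSubmonoid.closure_induction with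
  | mem g hg => exact hG g hg
  | zero => exact ⟨1, U.one_mem, .one hp⟩
  | add d e _ _ hd he =>
    obtain ⟨f, hf, hfd⟩ := hd
    obtain ⟨g, hg, hge⟩ := he
    exact ⟨f * g, U.mul_mem hf hg, hfd.mul hp hge⟩

/-- Successive approximation: a subring is contained in another one as soon as its exponents occur
there too. The leading coefficient is made divisible by higher and higher powers of `p`, until the
leading term lies in the ideal and can be dropped. -/
lemma le_of_leadingExponents_subset {p n N k : ℕ} (hp : p.Prime) (hn : 1 ≤ n) (hk : k ≤ N)
    {T U : Subring ℤ[X]} (hUT : U ≤ T) (hU : ∀ f ∈ truncIdeal p n N k, f ∈ U)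
    (h : leadingExponents p (truncWeight n N k) T ⊆
      leadingExponents p (truncWeight n N k) U) : T ≤ U := by
  have main : ∀ j i, i + j = n → ∀ f ∈ T, (∀ l < i, f.coeff l = 0) → f ∈ U := by
    intro j
    induction j with
    | zero =>
      intro i hi f _ hf0
      refine hU f ((mem_truncIdeal_iff hn hk).mpr fun l => ?_)
      by_cases hl : l < i
      · rw [hf0 l hl]
        exact dvd_zero _
      · rw [truncWeight, if_neg (by omega), if_neg (by omega), pow_zero]
        exact one_dvd _
    | succ j ihj =>
      intro i hi
      -- `t` bounds the number of times `p` must still be gained in the coefficient of `X ^ i`.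
      have step : ∀ t m, truncWeight n N k i ≤ m + t → ∀ f ∈ T, (∀ l < i, f.coeff l = 0) →
          (p : ℤ) ^ m ∣ f.coeff i → f ∈ U := by
        intro t
        induction t with
        | zero =>
          intro m hm f hf hf0 hd
          have hterm : C (f.coeff i) * X ^ i ∈ U := hU _
            ((C_mul_X_pow_mem_truncIdeal_iff hn hk _ _).mpr ((pow_dvd_pow _ hm).trans hd))
          have := ihj (i + 1) (by omega) _ (T.sub_mem hf (hUT hterm)) fun l hl => ?_
          · simpa using U.add_mem this hterm
          · rw [coeff_sub, coeff_C_mul_X_pow]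
            split_ifs with hli
            · rw [hli, sub_self]
            · rw [hf0 l (by omega), sub_zero]
        | succ t iht =>
          intro m hm f hf hf0 hd
          by_cases hma : truncWeight n N k i ≤ m
          · exact iht m (by omega) f hf hf0 hd
          obtain ⟨u, hu⟩ := hd
          by_cases hpu : (p : ℤ) ∣ u
          · refine iht (m + 1) (by omega) f hf hf0 ?_
            rw [hu, pow_succ]
            exact mul_dvd_mul_left _ hpu
          · obtain ⟨_, g, hg, hg0, v, hv, hgv⟩ :=
              h (show (i, m) ∈ _ from ⟨by simpa using hma, f, hf, hf0, u, hpu, by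
                rw [hu, mul_comm]⟩)
            obtain ⟨c, hc⟩ := exists_dvd_sub_mul hp u hv
            have hcg : C c * g ∈ U := by
              rw [← smul_eq_C_mul]
              exact U.zsmul_mem hg c
            have := iht (m + 1) (by omega) _ (T.sub_mem hf (hUT hcg)) (fun l hl => ?_) ?_
            · simpa using U.add_mem this hcg
            · rw [coeff_sub, coeff_C_mul, hf0 l hl, hg0 l hl, mul_zero, sub_zero]
            · have : (f - C c * g).coeff i = (p : ℤ) ^ m * (u - c * v) := by
                simp only at hgv
                rw [coeff_sub, coeff_C_mul, hu, hgv]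
                ring
              rw [this, pow_succ]
              exact mul_dvd_mul_left _ hc
      exact fun f hf hf0 => step _ 0 (Nat.le_add_left _ _) f hf hf0 (by simp)
  exact fun f hf => main n 0 (by omega) f hf (by simp)

/-! ### The step from `k + 1` to `k` -/

lemma lt_truncWeight_succ_iff {n N k : ℕ} {e : ℕ × ℕ} :
    e.2 < truncWeight (n + 1) N (k + 1) e.1 ↔
      e.2 < truncWeight (n + 1) N k e.1 ∨ e = (n, k) := by
  obtain ⟨i, m⟩ := e
  simp only [truncWeight, Prod.mk.injEq]
  split_ifs <;> omega

lemma not_lt_truncWeight_self (n N k : ℕ) : ¬ k < truncWeight (n + 1) N k n := by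
  simp [truncWeight]

/-- A subring with an element of exponent `(n, k)` contains `p ^ k * X ^ n`, hence is already a
preimage from the smaller quotient. -/
lemma liftedSubrings_subset_erase {p n N k : ℕ} (hp : p.Prime) (hk : k + 1 ≤ N)
    {D : Finset (ℕ × ℕ)} (hD : (n, k) ∈ D) :
    liftedSubrings p (n + 1) N (k + 1) D ⊆ liftedSubrings p (n + 1) N k (D.erase (n, k)) := by
  rintro T ⟨hT, hTD⟩
  constructor
  · have hmem : (n, k) ∈ leadingExponents p (truncWeight (n + 1) N (k + 1)) T := by
      rw [hTD]; exact_mod_cast hD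
    obtain ⟨_, f, hf, hf0, u, hu, hfu⟩ := hmem
    simp only at hf0 hfu
    have hq (c : ℤ) : C (c * (p : ℤ) ^ k) * X ^ n ∈ T := by
      obtain ⟨b, d, hb⟩ := exists_dvd_sub_mul hp c hu
      have hmul : C b * f ∈ T := by
        rw [← smul_eq_C_mul]
        exact T.zsmul_mem hf b
      have := T.sub_mem hmul (hT (C b * f - C (c * (p : ℤ) ^ k) * X ^ n) ?_)
      · simpa using this
      · rw [mem_truncIdeal_iff (by omega) hk]
        intro i
        rw [coeff_sub, coeff_C_mul, coeff_C_mul_X_pow]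
        rcases lt_trichotomy i n with h | rfl | h
        · rw [hf0 i h, if_neg h.ne]
          simp
        · rw [if_pos rfl, hfu]
          simp only [truncWeight, lt_irrefl, if_false, if_true]
          exact ⟨-d, by linear_combination (-(p : ℤ) ^ k) * hb⟩
        · rw [truncWeight, if_neg (by omega), if_neg (by omega), pow_zero]
          exact one_dvd _
    intro g hg
    obtain ⟨c, hc⟩ := exists_sub_mem_truncIdeal_succ hk hg
    simpa using T.add_mem (hT _ hc) (hq c)
  · rw [Finset.coe_erase, ← hTD]
    ext e
    constructor
    · rintro ⟨h, hf⟩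
      refine ⟨⟨lt_truncWeight_succ_iff.mpr (.inl h), hf⟩, ?_⟩
      rintro rfl
      exact not_lt_truncWeight_self _ _ _ h
    · rintro ⟨⟨h, hf⟩, hne⟩
      exact ⟨(lt_truncWeight_succ_iff.mp h).resolve_right hne, hf⟩

/-- The subring `T + I` of `A`, for a subring `T` and an ideal `I`. -/
def Subring.addIdeal {A : Type*} [CommRing A] (T : Subring A) (I : Ideal A) : Subring A :=
  (T.map (Ideal.Quotient.mk I)).comap (Ideal.Quotient.mk I)

lemma Subring.mem_addIdeal {A : Type*} [CommRing A] {T : Subring A} {I : Ideal A} {x : A} :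
    x ∈ T.addIdeal I ↔ ∃ t ∈ T, t - x ∈ I := by
  simp only [Subring.addIdeal, Subring.mem_comap, Subring.mem_map,
    Ideal.Quotient.mk_eq_mk_iff_sub_mem]

/-- Every element of `T + (p ^ k * X ^ n)` becomes an element of `T` by adding a multiple of
`p ^ k * X ^ n`, and the factor matters modulo `p` only. -/
lemma exists_add_mem_of_mem_addIdeal {p n N k : ℕ} (hp : p.Prime) (hk : k + 1 ≤ N)
    {T : Subring ℤ[X]} (hT : ∀ f ∈ truncIdeal p (n + 1) N (k + 1), f ∈ T) {f : ℤ[X]}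
    (hf : f ∈ T.addIdeal (truncIdeal p (n + 1) N k)) :
    ∃ c : Fin p, f + C (((c : ℕ) : ℤ) * (p : ℤ) ^ k) * X ^ n ∈ T := by
  obtain ⟨t, ht, htf⟩ := Subring.mem_addIdeal.mp hf
  obtain ⟨c, hc⟩ := exists_sub_mem_truncIdeal_succ hk htf
  have hp0 : (p : ℤ) ≠ 0 := by exact_mod_cast hp.ne_zero
  have hnn := Int.emod_nonneg c hp0
  have hlt := Int.emod_lt_of_pos c (show (0 : ℤ) < p by exact_mod_cast hp.pos)
  refine ⟨⟨(c % p).toNat, by omega⟩, ?_⟩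
  have hdiff : C ((c / p) * (p : ℤ) ^ (k + 1)) * X ^ n ∈ T := hT _ <| by
    rw [C_mul_X_pow_mem_truncIdeal_iff (by omega) hk]
    simp [truncWeight]
  have hsum := T.sub_mem (T.sub_mem ht (hT _ hc)) hdiff
  convert hsum using 1
  simp only [Int.toNat_of_nonneg hnn]
  have : c * (p : ℤ) ^ k = (c % p) * (p : ℤ) ^ k + (c / p) * (p : ℤ) ^ (k + 1) := by
    conv_lhs => rw [← Int.emod_add_mul_ediv c p]
    ring
  rw [this, C_add]
  ring

lemma addIdeal_mem_liftedSubrings {p n N k : ℕ} (hp : p.Prime) (hk : k + 1 ≤ N)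
    {D : Finset (ℕ × ℕ)} (hD : (n, k) ∉ D) {T : Subring ℤ[X]}
    (hT : T ∈ liftedSubrings p (n + 1) N (k + 1) D) :
    T.addIdeal (truncIdeal p (n + 1) N k) ∈ liftedSubrings p (n + 1) N k D := by
  obtain ⟨hT, hTD⟩ := hT
  refine ⟨fun f hf => Subring.mem_addIdeal.mpr ⟨0, T.zero_mem, by simpa using hf⟩, ?_⟩
  rw [← hTD]
  ext e
  constructor
  · rintro ⟨he, f, hf, hfe⟩
    obtain ⟨c, hc⟩ := exists_add_mem_of_mem_addIdeal hp hk hT hf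
    exact ⟨lt_truncWeight_succ_iff.mpr (.inl he), _, hc, hfe.add_C_mul_X_pow he _⟩
  · intro he
    have hne : e ≠ (n, k) := by
      rintro rfl
      rw [hTD] at he
      exact hD (by exact_mod_cast he)
    obtain ⟨h, f, hf, hfe⟩ := he
    exact ⟨(lt_truncWeight_succ_iff.mp h).resolve_right hne, f,
      Subring.mem_addIdeal.mpr ⟨f, hf, by simp⟩, hfe⟩

/-- As `(0, 1)` is not a sum of other elements of `ℕ × ℕ`, it belongs to each generating set. -/
lemma zero_one_mem_of_mem_closure {G : Set (ℕ × ℕ)}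
    (h : ((0, 1) : ℕ × ℕ) ∈ AddSubmonoid.closure G) : ((0, 1) : ℕ × ℕ) ∈ G := by
  by_contra hG
  have aux : ∀ e ∈ AddSubmonoid.closure G, e ≠ ((0, 1) : ℕ × ℕ) := by
    intro e he
    induction he using AddSubmonoid.closure_induction with
    | mem g hg => rintro rfl; exact hG hg
    | zero => simp [Prod.ext_iff]
    | add d e _ _ hd he =>
      obtain ⟨d1, d2⟩ := d
      obtain ⟨e1, e2⟩ := e
      simp only [Prod.mk_add_mk, ne_eq, Prod.mk.injEq] at *
      omega
  exact aux _ h rfl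

/-- An element of `T` with the leading exponent `g`, with junk value `0` if there is none. -/
noncomputable def leadingRep (p : ℕ) (T : Subring ℤ[X]) (g : ℕ × ℕ) : ℤ[X] :=
  open scoped Classical in
  if h : ∃ f ∈ T, HasLeadingTerm p f g then h.choose else 0

lemma leadingRep_spec {p : ℕ} {T : Subring ℤ[X]} {g : ℕ × ℕ}
    (h : ∃ f ∈ T, HasLeadingTerm p f g) :
    leadingRep p T g ∈ T ∧ HasLeadingTerm p (leadingRep p T g) g := by
  rw [leadingRep, dif_pos h]
  exact h.choose_spec

lemma HasLeadingTerm.natCast_prime {p : ℕ} (hp : p.Prime) :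
    HasLeadingTerm p (p : ℤ[X]) (0, 1) :=
  ⟨by simp, 1, (Nat.prime_iff_prime_int.mp hp).not_dvd_one, by simp⟩

/-- Two subrings with the same exponents coincide if they have the same sum with the larger ideal
and contain the same lifts of elements whose exponents generate `D`, apart from `(0, 1)`. -/
lemma eq_of_common_lifts {p n N k : ℕ} (hp : p.Prime) (hk : k + 1 ≤ N)
    {D G : Finset (ℕ × ℕ)} (hGD : G ⊆ D)
    (hG : (D : Set (ℕ × ℕ)) ⊆ AddSubmonoid.closure (G : Set (ℕ × ℕ)))
    {T₁ T₂ T' : Subring ℤ[X]}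
    (hT₁ : T₁ ∈ liftedSubrings p (n + 1) N (k + 1) D)
    (hT₂ : T₂ ∈ liftedSubrings p (n + 1) N (k + 1) D)
    (hT' : T' ∈ liftedSubrings p (n + 1) N k D) (c : ↥(G.erase (0, 1)) → ℤ)
    (hc₁ : ∀ g, leadingRep p T' g.1 + C (c g * (p : ℤ) ^ k) * X ^ n ∈ T₁)
    (hc₂ : ∀ g, leadingRep p T' g.1 + C (c g * (p : ℤ) ^ k) * X ^ n ∈ T₂) : T₁ = T₂ := by
  have hlead : ∀ g ∈ (G : Set (ℕ × ℕ)), ∃ f ∈ T₁ ⊓ T₂, HasLeadingTerm p f g := by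
    intro g hg
    by_cases h01 : g = (0, 1)
    · subst h01
      exact ⟨p, natCast_mem _ p, .natCast_prime hp⟩
    · have hgD : g ∈ leadingExponents p (truncWeight (n + 1) N k) T' := by
        rw [hT'.2]; exact_mod_cast hGD hg
      exact ⟨_, ⟨hc₁ ⟨g, Finset.mem_erase.mpr ⟨h01, hg⟩⟩, hc₂ ⟨g, Finset.mem_erase.mpr ⟨h01, hg⟩⟩⟩,
        (leadingRep_spec hgD.2).2.add_C_mul_X_pow hgD.1 _⟩
  have hIU : ∀ f ∈ truncIdeal p (n + 1) N (k + 1), f ∈ T₁ ⊓ T₂ :=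
    fun f hf => ⟨hT₁.1 f hf, hT₂.1 f hf⟩
  have hle {T : Subring ℤ[X]} (hT : T ∈ liftedSubrings p (n + 1) N (k + 1) D)
      (hU : T₁ ⊓ T₂ ≤ T) : T ≤ T₁ ⊓ T₂ := by
    refine le_of_leadingExponents_subset hp (by omega) hk hU hIU fun e he => ⟨he.1, ?_⟩
    rw [hT.2] at he
    exact exists_hasLeadingTerm_of_mem_closure hp hlead (hG he)
  exact le_antisymm ((hle hT₁ inf_le_left).trans inf_le_right)
    ((hle hT₂ inf_le_right).trans inf_le_left)

lemma exists_minGenerators (D : Finset (ℕ × ℕ)) : ∃ G : Finset (ℕ × ℕ), G ⊆ D ∧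
    (D : Set (ℕ × ℕ)) ⊆ AddSubmonoid.closure (G : Set (ℕ × ℕ)) ∧ G.card = minGenerators D :=
  Nat.sInf_mem (s := {c | ∃ G : Finset (ℕ × ℕ), G ⊆ D ∧
    (D : Set (ℕ × ℕ)) ⊆ AddSubmonoid.closure (G : Set (ℕ × ℕ)) ∧ G.card = c})
    ⟨_, D, subset_rfl, AddSubmonoid.subset_closure, rfl⟩

/-- If `(n, k) ∉ D`, the subrings over a given subring of the smaller quotient are parametrized by
the lifts of all generators but `(0, 1)`, with `p` choices for each. -/
lemma card_liftedSubrings_succ_le {p n N k : ℕ} (hp : p.Prime) (hn : 1 ≤ n) (hN : 2 ≤ N)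
    (hk : k + 1 ≤ N) {D : Finset (ℕ × ℕ)} (hD : (n, k) ∉ D)
    (hfin : (liftedSubrings p (n + 1) N k D).Finite)
    (hne : (liftedSubrings p (n + 1) N (k + 1) D).Nonempty) :
    1 ≤ minGenerators D ∧ (liftedSubrings p (n + 1) N (k + 1) D).Finite ∧
      (liftedSubrings p (n + 1) N (k + 1) D).ncard ≤
        p ^ (minGenerators D - 1) * (liftedSubrings p (n + 1) N k D).ncard := by
  obtain ⟨G, hGD, hG, hcard⟩ := exists_minGenerators D
  have h01 : ((0, 1) : ℕ × ℕ) ∈ G := by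
    obtain ⟨T, _, hTD⟩ := hne
    have : ((0, 1) : ℕ × ℕ) ∈ leadingExponents p (truncWeight (n + 1) N (k + 1)) T := by
      refine ⟨?_, p, natCast_mem _ p, .natCast_prime hp⟩
      rw [truncWeight, if_pos (show 0 + 1 < n + 1 by omega)]
      exact hN
    rw [hTD] at this
    exact_mod_cast zero_one_mem_of_mem_closure (hG this)
  have hlift (T : liftedSubrings p (n + 1) N (k + 1) D) (g : ↥(G.erase (0, 1))) :
      ∃ c : Fin p, leadingRep p (T.1.addIdeal (truncIdeal p (n + 1) N k)) g +
        C (((c : ℕ) : ℤ) * (p : ℤ) ^ k) * X ^ n ∈ T.1 := by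
    have hT' := addIdeal_mem_liftedSubrings hp hk hD T.2
    refine exists_add_mem_of_mem_addIdeal hp hk T.2.1 (leadingRep_spec ?_).1
    have : g.1 ∈ leadingExponents p (truncWeight (n + 1) N k)
        (T.1.addIdeal (truncIdeal p (n + 1) N k)) := by
      rw [hT'.2]; exact_mod_cast hGD (Finset.mem_of_mem_erase g.2)
    exact this.2
  choose c hc using hlift
  let φ (T : liftedSubrings p (n + 1) N (k + 1) D) :
      (↥(G.erase (0, 1)) → Fin p) × liftedSubrings p (n + 1) N k D :=
    (c T, ⟨_, addIdeal_mem_liftedSubrings hp hk hD T.2⟩)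
  have hφ : Function.Injective φ := by
    intro T₁ T₂ h
    obtain ⟨h1, h2⟩ := Prod.mk.inj h
    have h2 : T₁.1.addIdeal (truncIdeal p (n + 1) N k) = T₂.1.addIdeal (truncIdeal p (n + 1) N k) :=
      congrArg Subtype.val h2
    refine Subtype.ext (eq_of_common_lifts hp hk hGD hG T₁.2 T₂.2
      (addIdeal_mem_liftedSubrings hp hk hD T₁.2) (fun g => ((c T₁ g : ℕ) : ℤ)) (hc T₁) fun g => ?_)
    have := hc T₂ g
    rwa [← h1, ← h2] at this
  have := hfin.to_subtype
  refine ⟨hcard ▸ Finset.card_pos.mpr ⟨_, h01⟩,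
    Set.finite_coe_iff.mp (Finite.of_injective φ hφ), ?_⟩
  have hle := Nat.card_le_card_of_injective φ hφ
  rwa [Nat.card_prod, Nat.card_fun, Nat.card_fin, Nat.card_eq_finsetCard,
    Finset.card_erase_of_mem h01, hcard] at hle

/-! ### The bound -/

lemma liftedSubrings_one_subsingleton (p N k : ℕ) (D : Finset (ℕ × ℕ)) :
    (liftedSubrings p 1 N k D).Subsingleton := by
  have htop {T : Subring ℤ[X]} (hT : T ∈ liftedSubrings p 1 N k D) : T = ⊤ := by
    refine eq_top_iff.mpr fun f _ => ?_
    have hX : X * f.divX ∈ T := hT.1 _ <| Ideal.mul_mem_right _ _ <|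
      Ideal.subset_span (by simp)
    have hC : C (f.coeff 0) ∈ T := by
      simp
    have := T.add_mem hX hC
    rwa [X_mul_divX_add] at this
  intro T hT U hU
  rw [htop hT, htop hU]

lemma ncard_liftedSubrings_le {p N : ℕ} (hp : p.Prime) (hN : 2 ≤ N) :
    ∀ (n k : ℕ), k ≤ N → ∀ D : Finset (ℕ × ℕ), (liftedSubrings p (n + 1) N k D).Finite ∧
      ((liftedSubrings p (n + 1) N k D).ncard : ℚ) ≤ (p : ℚ) ^ shapeEps N (n + 1) k D := by
  have hp0 : (p : ℚ) ≠ 0 := by exact_mod_cast hp.ne_zero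
  intro n
  induction n with
  | zero =>
    intro k hk D
    have hs := liftedSubrings_one_subsingleton p N k D
    refine ⟨hs.finite, ?_⟩
    rw [show shapeEps N (0 + 1) k D = 0 by rw [shapeEps], zpow_zero]
    exact_mod_cast (@Set.ncard_le_one_iff_subsingleton _ _ hs.finite.to_subtype).mpr hs
  | succ n ihn =>
    intro k
    induction k with
    | zero =>
      intro _ D
      rw [liftedSubrings_zero_eq, shapeEps]
      exact ihn N le_rfl D
    | succ k ihk =>
      intro hk D
      rw [shapeEps]
      split_ifs with hD
      · have hsub := liftedSubrings_subset_erase hp hk hD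
        obtain ⟨hfin, hcard⟩ := ihk (by omega) (D.erase (n + 1, k))
        refine ⟨hfin.subset hsub, le_trans ?_ hcard⟩
        exact_mod_cast Set.ncard_le_ncard hsub hfin
      · obtain ⟨hfin, hcard⟩ := ihk (by omega) D
        rcases Set.eq_empty_or_nonempty (liftedSubrings p (n + 1 + 1) N (k + 1) D) with he | hne
        · rw [he]
          exact ⟨Set.finite_empty, by rw [Set.ncard_empty]; positivity⟩
        obtain ⟨hd, hfin', hle⟩ := card_liftedSubrings_succ_le hp (by omega) hN hk hD hfin hne
        refine ⟨hfin', ?_⟩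
        have hsub : (minGenerators D : ℤ) - 1 = (minGenerators D - 1 : ℕ) := by omega
        rw [zpow_add₀ hp0, hsub, zpow_natCast]
        refine le_trans (by exact_mod_cast hle) (mul_le_mul_of_nonneg_left hcard (by positivity))

lemma exponentSet_eq_leadingExponents {p n N k : ℕ} (hp : p.Prime) (hn : 1 ≤ n) (hk : k ≤ N)
    {S : Subring (TruncRing p n N k)} :
    exponentSet S = leadingExponents p (truncWeight n N k)
      (S.comap (Ideal.Quotient.mk (truncIdeal p n N k))) := by
  have hp1 : (p : ℤ) ≠ 0 := by exact_mod_cast hp.ne_zero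
  have hpu : ¬ IsUnit (p : ℤ) := (Nat.prime_iff_prime_int.mp hp).not_isUnit
  ext e
  have hnz : Ideal.Quotient.mk (truncIdeal p n N k) (C ((p : ℤ) ^ e.2) * X ^ e.1) ≠ 0 ↔
      e.2 < truncWeight n N k e.1 := by
    rw [ne_eq, Ideal.Quotient.eq_zero_iff_mem, C_mul_X_pow_mem_truncIdeal_iff hn hk,
      pow_dvd_pow_iff hp1 hpu, not_le]
  constructor
  · rintro ⟨_, hr, h0, u, g, hu, rfl⟩
    refine ⟨hnz.mp h0, _, hr, fun l hl => ?_, u, hu, ?_⟩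
    · rw [coeff_add, coeff_C_mul_X_pow, if_neg hl.ne, coeff_X_pow_mul', if_neg (by omega), add_zero]
    · rw [coeff_add, coeff_C_mul_X_pow, if_pos rfl, coeff_X_pow_mul', if_neg (by omega), add_zero]
  · rintro ⟨h0, f, hf, hf0, u, hu, hfu⟩
    refine ⟨_, hf, hnz.mpr h0, u, ?_⟩
    have hdvd : X ^ (e.1 + 1) ∣ f - C (u * (p : ℤ) ^ e.2) * X ^ e.1 := by
      refine X_pow_dvd_iff.mpr fun l hl => ?_
      rw [coeff_sub, coeff_C_mul_X_pow]
      split_ifs with h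
      · rw [h, hfu, sub_self]
      · rw [hf0 l (by omega), sub_zero]
    obtain ⟨g, hg⟩ := hdvd
    exact ⟨g, hu, by rw [← hg, add_sub_cancel]⟩

theorem theorem43 (p n N k : ℕ) (hp : p.Prime) (hn : 2 ≤ n) (hN : 2 ≤ N) (hk : k ≤ N)
    (D : Finset (ℕ × ℕ)) (hD : D ⊆ exponentBox n N) :
    (subringsOfShape p n N k D).Finite ∧
      ((subringsOfShape p n N k D).ncard : ℚ) ≤ (p : ℚ) ^ shapeEps N n k D := by
  obtain ⟨n, rfl⟩ := Nat.exists_eq_add_of_le' (show 1 ≤ n by omega)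
  obtain ⟨hfin, hcard⟩ := ncard_liftedSubrings_le hp hN n k hk D
  let F : Subring (TruncRing p (n + 1) N k) → Subring ℤ[X] :=
    Subring.comap (Ideal.Quotient.mk (truncIdeal p (n + 1) N k))
  have hinj : Function.Injective F := fun S S' h => by
    ext x
    obtain ⟨f, rfl⟩ := Ideal.Quotient.mk_surjective x
    exact SetLike.ext_iff.mp h f
  have hmaps : Set.MapsTo F (subringsOfShape p (n + 1) N k D) (liftedSubrings p (n + 1) N k D) := by
    intro S hS
    refine ⟨fun f hf => ?_, ?_⟩
    · rw [Subring.mem_comap, Ideal.Quotient.eq_zero_iff_mem.mpr hf]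
      exact S.zero_mem
    · rw [← exponentSet_eq_leadingExponents hp (by omega) hk]
      exact hS
  refine ⟨Set.Finite.of_injOn hmaps hinj.injOn hfin, le_trans ?_ hcard⟩
  exact_mod_cast Set.ncard_le_ncard_of_injOn F hmaps hinj.injOn hfin
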